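/- All locally convex spaces are real and Hausdorff, and all manifolds are Hausdorff. "Smooth" means $C^\infty$ in the sense of Michal–Bastiani (directional derivatives of all orders exist and are jointly continuous) throughout, or else "smooth" means real analytic throughout (a map between open subsets of locally convex spaces is real analytic if it locally extends to a complex analytic, i.e. $C^\infty_{\mathbb C}$, map between the complexifications); the statement holds in both settings. Let $G$ be a Lie group modelled on a locally convex space, and let $B\subseteq G$ be a closed subgroup for which there is a subset $N\subseteq G$ (with the subspace topology) such that: 1. $\mathbf 1\in N$; 2. $N$ is homeomorphic to an open subset of some locally convex space $F$, and for the manifold structure on $N$ given by this homeomorphism the inclusion $N\hookrightarrow G$ is smooth; 3. there is an open neighborhood $\Omega$ of $\mathbf 1$ in $G$ such that multiplication $N\times B\to\Omega$, $(n,b)\mapsto nb$, is a homeomorphism, and the corresponding projection $\sigma\colon\Omega\to N$, $nb\mapsto n$, is smooth. Then the inverses of the maps $\psi_g\colon N\to G/B$, $n\mapsto gnB$ $(g\in G)$, composed with the homeomorphism of $N$ onto an open subset of $F$, are the charts of an atlas which makes $G/B$, with the quotient topology, a (Hausdorff) manifold modelled on $F$. For this structure the projection $\pi\colon G\to G/B$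 is smooth and open, and the action $G\times G/B\to G/B$, $(g,hB)\mapsto ghB$, is smooth. Moreover, if $N'\subseteq G$ is another subset satisfying (1)–(3) (with a possibly different model space $F'$), then $N'$ defines in this way the same smooth structure on $G/B$, i.e. the identity of $G/B$ is smooth in both directions between the two structures. -/

import Mathlib

open Set Filter Topology

namespace LCLie

universe u v

/-! ### Differential calculus in locally convex spaces -/

/-- `f` is of class `C^n` over `𝕜` on the open set `U`, in the sense of Michal and Bastiani:
`C^0` means continuous, and `f` is `C^(n+1)` if it is continuous, all directional derivatives
`df (x, h) = lim (t → 0) t⁻¹ (f (x + t h) - f x)`, `x ∈ U`, exist, and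
`df : U × E → F` is `C^n`. -/
def CDiffOn (𝕜 : Type*) [NontriviallyNormedField 𝕜]
    {F : Type v} [AddCommGroup F] [Module 𝕜 F] [TopologicalSpace F] :
    ℕ → ∀ {E : Type u} [AddCommGroup E] [Module 𝕜 E] [TopologicalSpace E],
      (E → F) → Set E → Prop
  | 0, _, _, _, _, f, U => ContinuousOn f U
  | n + 1, E, _, _, _, f, U =>
      ContinuousOn f U ∧ ∃ df : E × E → F,
        (∀ x ∈ U, ∀ h : E,
          Tendsto (fun t : 𝕜 => t⁻¹ • (f (x + t • h) - f x)) (𝓝[≠] 0) (𝓝 (df (x, h)))) ∧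
        CDiffOn 𝕜 n df (U ×ˢ (univ : Set E))

/-- `C^∞` maps over `𝕜` on an open set. Over `𝕜 = ℂ` these are the complex analytic
(holomorphic) maps between complex locally convex spaces. -/
def CInftyOn (𝕜 : Type*) [NontriviallyNormedField 𝕜]
    {E : Type u} [AddCommGroup E] [Module 𝕜 E] [TopologicalSpace E]
    {F : Type v} [AddCommGroup F] [Module 𝕜 F] [TopologicalSpace F]
    (f : E → F) (U : Set E) : Prop :=
  ∀ n : ℕ, CDiffOn 𝕜 n f U

/-- The complexification `E ⊕ iE` of a real topological vector space,
with the product topology. -/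
def Complexify (E : Type u) : Type u := E × E

namespace Complexify

variable {E : Type u}

/-- The vector `x + i y`. -/
def mk (x y : E) : Complexify E := (x, y)

/-- The real part of a vector. -/
def re (z : Complexify E) : E := z.1

/-- The imaginary part of a vector. -/
def im (z : Complexify E) : E := z.2

instance [AddCommGroup E] : AddCommGroup (Complexify E) :=
  inferInstanceAs (AddCommGroup (E × E))

instance [TopologicalSpace E] : TopologicalSpace (Complexify E) :=
  inferInstanceAs (TopologicalSpace (E × E))

theorem ext' {z w : Complexify E} (h : z.re = w.re) (h' : z.im = w.im) : z = w :=
  Prod.ext h h'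

/-- `(a + i b)(x + i y) = (a x - b y) + i (a y + b x)`. -/
instance [AddCommGroup E] [Module ℝ E] : Module ℂ (Complexify E) where
  smul c z := mk (c.re • z.re - c.im • z.im) (c.re • z.im + c.im • z.re)
  one_smul z := by
    apply ext'
    · change (1 : ℂ).re • z.re - (1 : ℂ).im • z.im = z.re
      simp
    · change (1 : ℂ).re • z.im + (1 : ℂ).im • z.re = z.im
      simp
  mul_smul c d z := by
    apply ext'
    · change (c * d).re • z.re - (c * d).im • z.im =
        c.re • (d.re • z.re - d.im • z.im) - c.im • (d.re • z.im + d.im • z.re)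
      simp only [Complex.mul_re, Complex.mul_im]
      module
    · change (c * d).re • z.im + (c * d).im • z.re =
        c.re • (d.re • z.im + d.im • z.re) + c.im • (d.re • z.re - d.im • z.im)
      simp only [Complex.mul_re, Complex.mul_im]
      module
  smul_zero c := by
    apply ext'
    · change c.re • (0 : E) - c.im • (0 : E) = 0
      simp
    · change c.re • (0 : E) + c.im • (0 : E) = 0
      simp
  smul_add c z w := by
    apply ext'
    · change c.re • (z.re + w.re) - c.im • (z.im + w.im) =
        (c.re • z.re - c.im • z.im) + (c.re • w.re - c.im • w.im)
      module
    · change c.re • (z.im + w.im) + c.im • (z.re + w.re) =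
        (c.re • z.im + c.im • z.re) + (c.re • w.im + c.im • w.re)
      module
  add_smul c d z := by
    apply ext'
    · change (c + d).re • z.re - (c + d).im • z.im =
        (c.re • z.re - c.im • z.im) + (d.re • z.re - d.im • z.im)
      simp only [Complex.add_re, Complex.add_im]
      module
    · change (c + d).re • z.im + (c + d).im • z.re =
        (c.re • z.im + c.im • z.re) + (d.re • z.im + d.im • z.re)
      simp only [Complex.add_re, Complex.add_im]
      module
  zero_smul z := by
    apply ext'
    · change (0 : ℂ).re • z.re - (0 : ℂ).im • z.im = 0
      simp
    · change (0 : ℂ).re • z.im + (0 : ℂ).im • z.re = 0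
      simp

end Complexify

/-- `f` is real analytic on the open set `U`: near each point of `U` it extends to a complex
analytic map between the complexifications. -/
def RealAnalyticOn {E : Type u} [AddCommGroup E] [Module ℝ E] [TopologicalSpace E]
    {F : Type v} [AddCommGroup F] [Module ℝ F] [TopologicalSpace F]
    (f : E → F) (U : Set E) : Prop :=
  ∀ x ∈ U, ∃ W : Set (Complexify E), IsOpen W ∧ Complexify.mk x 0 ∈ W ∧
    ∃ g : Complexify E → Complexify F, CInftyOn ℂ g W ∧
      ∀ y ∈ U, Complexify.mk y 0 ∈ W → g (Complexify.mk y 0) = Complexify.mk (f y) 0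

/-- The two categories of real manifolds under consideration. -/
inductive Regularity where
  | smooth
  | analytic

/-- Maps of the given regularity on an open subset of a real locally convex space. -/
def Regularity.DiffOn (r : Regularity)
    {E : Type u} [AddCommGroup E] [Module ℝ E] [TopologicalSpace E]
    {F : Type v} [AddCommGroup F] [Module ℝ F] [TopologicalSpace F]
    (f : E → F) (U : Set E) : Prop :=
  match r with
  | .smooth => CInftyOn ℝ f U
  | .analytic => RealAnalyticOn f U

/-! ### Manifolds and Lie groups modelled on locally convex spaces -/

section Manifolds

variable (r : Regularity)
  (E : Type*) [AddCommGroup E] [Module ℝ E] [TopologicalSpace E]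
  (F : Type*) [AddCommGroup F] [Module ℝ F] [TopologicalSpace F]

/-- `M` is a Hausdorff space and its charts are compatible: `M` is a manifold modelled on `E`. -/
class IsLCManifold (M : Type*) [TopologicalSpace M] [ChartedSpace E M] : Prop where
  t2 : T2Space M
  compatible : ∀ e ∈ atlas E M, ∀ e' ∈ atlas E M,
    r.DiffOn (e' ∘ e.symm) (e.target ∩ e.symm ⁻¹' e'.source)

/-- The map `f : M → M'` between manifolds modelled on `E` and `F` is smooth
(resp. real analytic) on the open subset `U` of `M`. -/
def MapDiffOn {M : Type*} [TopologicalSpace M] [ChartedSpace E M]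
    {M' : Type*} [TopologicalSpace M'] [ChartedSpace F M'] (f : M → M') (U : Set M) : Prop :=
  ContinuousOn f U ∧ ∀ e ∈ atlas E M, ∀ e' ∈ atlas F M',
    r.DiffOn (e' ∘ f ∘ e.symm) (e.target ∩ e.symm ⁻¹' (U ∩ f ⁻¹' e'.source))

/-- The map `f : M → M'` between manifolds modelled on `E` and `F` is smooth
(resp. real analytic). -/
def MapDiff {M : Type*} [TopologicalSpace M] [ChartedSpace E M]
    {M' : Type*} [TopologicalSpace M'] [ChartedSpace F M'] (f : M → M') : Prop :=
  MapDiffOn r E F f univ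

/-- The product manifold, modelled on the vector space `E × F`; its charts are the products of
charts. -/
instance prodCharts (M : Type*) [TopologicalSpace M] [ChartedSpace E M]
    (M' : Type*) [TopologicalSpace M'] [ChartedSpace F M'] : ChartedSpace (E × F) (M × M') :=
  prodChartedSpace E M F M'

/-- `G` is a Lie group modelled on the locally convex space `E`. -/
class IsLCLieGroup (G : Type*) [Group G] [TopologicalSpace G] [ChartedSpace E G] : Prop
    extends IsLCManifold r E G where
  mul_diff : MapDiff r (E × E) E (fun p : G × G => p.1 * p.2)
  inv_diff : MapDiff r E E (fun g : G => g⁻¹)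

/-- A slice for the subgroup `B` of `G`, modelled on `F`: a subset `N` of `G` containing `1`,
homeomorphic through `chart` to an open subset of `F`, with smooth inclusion into `G`, such that
multiplication is a homeomorphism of `N × B` onto an open neighbourhood `Ω` of `1` for which the
projection `Ω → N`, `n b ↦ n`, is smooth. The values of `proj` outside `Ω` are irrelevant. -/
structure QuotientSlice {G : Type*} [Group G] [TopologicalSpace G] [ChartedSpace E G]
    (B : Subgroup G) where
  N : Set G
  one_mem : (1 : G) ∈ N
  chart : OpenPartialHomeomorph N F
  chart_source : chart.source = univ
  incl_diff : letI : ChartedSpace F N := chart.singletonChartedSpace chart_source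
    MapDiff r F E (Subtype.val : N → G)
  Ω : Set G
  isOpen_Ω : IsOpen Ω
  one_mem_Ω : (1 : G) ∈ Ω
  isEmbedding_mul : IsEmbedding (fun p : N × B => (p.1 : G) * (p.2 : G))
  range_mul : range (fun p : N × B => (p.1 : G) * (p.2 : G)) = Ω
  proj : G → N
  proj_mul : ∀ (n : N) (b : B), proj ((n : G) * (b : G)) = n
  proj_diff : letI : ChartedSpace F N := chart.singletonChartedSpace chart_source
    MapDiffOn r E F proj Ω

variable {r E F}

/-- The atlas that a slice defines on `G ⧸ B`: for each `g : G`, the chart whose inverse is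
`n ↦ g n B` on `N`, where `N` is identified with an open subset of `F`. -/
def QuotientSlice.quotientAtlas {G : Type*} [Group G] [TopologicalSpace G] [ChartedSpace E G]
    {B : Subgroup G} (S : QuotientSlice r E F B) :
    Set (OpenPartialHomeomorph (G ⧸ B) F) :=
  {e | e.target = S.chart.target ∧ ∃ g : G, ∀ x ∈ S.chart.target,
    e.symm x = (QuotientGroup.mk (g * (S.chart.symm x : G)) : G ⧸ B)}

end Manifolds

end LCLie

open LCLie

/-!
The proof has an analytic and a geometric part.

The analytic part shows that smooth (resp. real analytic) maps between open subsets of locally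
convex spaces form a category with products in which smoothness is a local property. Only the
chain rule is not formal. By the mean value theorem, a difference quotient of a `C^1` map lies in
every open convex set that contains the directional derivatives along the segment; this is reduced
to real functions by the Hahn-Banach theorem (`inv_smul_sub_mem_of_convex`), so no completeness is
needed. Together with the joint continuity of `dg` and local convexity it shows that difference
quotients converge even along varying directions (`tendsto_inv_smul_sub`), which gives
`d(g ∘ f)(x, h) = dg (f x, df (x, h))`, and induction on the order yields `CDiffOn.comp`. It holds
over `ℝ` and over `ℂ`, and the latter case gives the composition of real analytic maps, by
composing their complex analytic extensions.

In the geometric part, let `x ↦ n(x)` be the parametrization of the slice by an open subset of `F`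
and `c : Ω → F` the smooth projection of `Ω = N B` to the slice, read in the coordinates of `N`.
Since `c` is constant on cosets of `B`, a chart of `G ⧸ B` with index `g` is `h B ↦ c(g⁻¹ h)`,
defined for `g⁻¹ h ∈ Ω`. So if `f` is a smooth map into `G`, then `f` followed by `G → G ⧸ B` is
`x ↦ c(g⁻¹ f(x))` in this chart, which is smooth (`QuotientSlice.diffOn_chart_mk_comp`). All
smoothness claims are instances: `f(x) = g' n(x)` gives the changes of charts, also between two
different slices, a chart of `G` gives the projection, and `f(y, x) = e⁻¹(y) g' n(x)` gives the
action in the chart `e` of `G`. The space `G ⧸ B` is Hausdorff because `B` is closed and the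
projection is open.
-/

namespace LCLie

universe u v w

/-! ### Maps of class `C^n` in the sense of Michal and Bastiani -/

section Basic

variable {𝕜 : Type*} [NontriviallyNormedField 𝕜]
  {E : Type u} [AddCommGroup E] [Module 𝕜 E] [TopologicalSpace E]
  {F : Type v} [AddCommGroup F] [Module 𝕜 F] [TopologicalSpace F]
  {H : Type w} [AddCommGroup H] [Module 𝕜 H] [TopologicalSpace H]
  {n : ℕ} {f : E → F} {U : Set E}

theorem CDiffOn.continuousOn (hf : CDiffOn 𝕜 n f U) : ContinuousOn f U := by
  cases n with
  | zero => exact hf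
  | succ n => exact hf.1

theorem CDiffOn.mono {U' : Set E} (hf : CDiffOn 𝕜 n f U) (hU : U' ⊆ U) : CDiffOn 𝕜 n f U' := by
  induction n generalizing E with
  | zero => exact ContinuousOn.mono hf hU
  | succ n ih =>
    obtain ⟨hc, df, hd, hdf⟩ := hf
    exact ⟨hc.mono hU, df, fun x hx => hd x (hU hx), ih hdf (prod_mono hU subset_rfl)⟩

theorem CDiffOn.of_succ (hf : CDiffOn 𝕜 (n + 1) f U) : CDiffOn 𝕜 n f U := by
  induction n generalizing E with
  | zero => exact hf.1
  | succ n ih =>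
    obtain ⟨hc, df, hd, hdf⟩ := hf
    exact ⟨hc, df, hd, ih hdf⟩

/-- Near `t = 0` the line `t ↦ x + t h` stays in any given neighbourhood of `x`. -/
theorem eventually_add_smul_mem [ContinuousAdd E] [ContinuousSMul 𝕜 E] {x : E} (hU : U ∈ 𝓝 x)
    (h : E) : ∀ᶠ t : 𝕜 in 𝓝[≠] 0, x + t • h ∈ U := by
  have hc : Tendsto (fun t : 𝕜 => x + t • h) (𝓝 0) (𝓝 x) := by
    have : Continuous fun t : 𝕜 => x + t • h := by fun_prop
    simpa using this.tendsto 0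
  exact (hc.mono_left nhdsWithin_le_nhds).eventually hU

theorem CDiffOn.congr [ContinuousAdd E] [ContinuousSMul 𝕜 E] {g : E → F} (hU : IsOpen U)
    (hf : CDiffOn 𝕜 n f U) (hfg : EqOn f g U) : CDiffOn 𝕜 n g U := by
  cases n with
  | zero => exact ContinuousOn.congr hf hfg.symm
  | succ n =>
    obtain ⟨hc, df, hd, hdf⟩ := hf
    refine ⟨hc.congr hfg.symm, df, fun x hx h => (hd x hx h).congr' ?_, hdf⟩
    filter_upwards [eventually_add_smul_mem (𝕜 := 𝕜) (hU.mem_nhds hx) h] with t ht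
    rw [hfg ht, hfg hx]

theorem CDiffOn.prodMk {g : E → H} (hf : CDiffOn 𝕜 n f U) (hg : CDiffOn 𝕜 n g U) :
    CDiffOn 𝕜 n (fun x => (f x, g x)) U := by
  induction n generalizing E with
  | zero => exact ContinuousOn.prodMk hf hg
  | succ n ih =>
    obtain ⟨hc, df, hd, hdf⟩ := hf
    obtain ⟨hc', dg, hd', hdg⟩ := hg
    exact ⟨hc.prodMk hc', fun p => (df p, dg p),
      fun x hx h => (hd x hx h).prodMk_nhds (hd' x hx h), ih hdf hdg⟩

theorem CDiffOn.comp_continuousLinearMap {g : F → H} {V : Set F} (hg : CDiffOn 𝕜 n g V)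
    (L : E →L[𝕜] F) : CDiffOn 𝕜 n (g ∘ L) (L ⁻¹' V) := by
  induction n generalizing E F with
  | zero => exact ContinuousOn.comp hg L.continuous.continuousOn fun _ hx => hx
  | succ n ih =>
    obtain ⟨hc, dg, hd, hdg⟩ := hg
    refine ⟨hc.comp L.continuous.continuousOn fun _ hx => hx, dg ∘ L.prodMap L,
      fun x hx h => ?_, ?_⟩
    · simpa using hd (L x) hx (L h)
    · exact (ih hdg (L.prodMap L)).mono fun p hp => ⟨hp.1, mem_univ _⟩

theorem CDiffOn.continuousLinearMap_comp (L : F →L[𝕜] H) (hf : CDiffOn 𝕜 n f U) :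
    CDiffOn 𝕜 n (L ∘ f) U := by
  induction n generalizing E with
  | zero => exact L.continuous.comp_continuousOn hf
  | succ n ih =>
    obtain ⟨hc, df, hd, hdf⟩ := hf
    refine ⟨L.continuous.comp_continuousOn hc, L ∘ df, fun x hx h => ?_, ih hdf⟩
    simpa [Function.comp_def] using (L.continuous.tendsto _).comp (hd x hx h)

theorem cDiffOn_const (c : F) (n : ℕ) (U : Set E) : CDiffOn 𝕜 n (fun _ : E => c) U := by
  induction n generalizing E c with
  | zero => exact continuousOn_const
  | succ n ih =>
    exact ⟨continuousOn_const, fun _ => 0, fun x _ h => by simp [tendsto_const_nhds], ih 0 _⟩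

theorem ContinuousLinearMap.cDiffOn (L : E →L[𝕜] F) (n : ℕ) (U : Set E) : CDiffOn 𝕜 n L U := by
  induction n generalizing E with
  | zero => exact L.continuous.continuousOn
  | succ n ih =>
    refine ⟨L.continuous.continuousOn, L ∘ (ContinuousLinearMap.snd 𝕜 E E), fun x _ h => ?_,
      ih (L.comp (ContinuousLinearMap.snd 𝕜 E E)) _⟩
    refine tendsto_const_nhds.congr' ?_
    filter_upwards [self_mem_nhdsWithin] with t (ht : t ≠ 0)
    simp [inv_smul_smul₀ ht]

/-- Being `C^n` is a local property: the local directional derivatives fit together because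
limits in the Hausdorff space `F` are unique. -/
theorem CDiffOn.of_locally [ContinuousAdd E] [ContinuousSMul 𝕜 E] [T2Space F] (hU : IsOpen U)
    (h : ∀ x ∈ U, ∃ W, IsOpen W ∧ x ∈ W ∧ CDiffOn 𝕜 n f (U ∩ W)) : CDiffOn 𝕜 n f U := by
  induction n generalizing E with
  | zero => exact continuousOn_of_locally_continuousOn h
  | succ n ih =>
    choose! W hW hxW hf using h
    choose! hc df hd hdf using hf
    refine ⟨continuousOn_of_locally_continuousOn fun x hx => ⟨W x, hW x hx, hxW x hx, hc x hx⟩,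
      fun p => df p.1 p, fun x hx h => hd x hx x ⟨hx, hxW x hx⟩ h, ?_⟩
    refine ih (hU.prod isOpen_univ) fun p hp =>
      ⟨W p.1 ×ˢ univ, (hW _ hp.1).prod isOpen_univ, ⟨hxW _ hp.1, mem_univ _⟩, ?_⟩
    rw [prod_inter_prod, univ_inter]
    refine (hdf p.1 hp.1).congr ((hU.inter (hW _ hp.1)).prod isOpen_univ) fun q hq => ?_
    exact tendsto_nhds_unique (hd p.1 hp.1 q.1 hq.1 q.2)
      (hd q.1 hq.1.1 q.1 ⟨hq.1.1, hxW _ hq.1.1⟩ q.2)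

end Basic

section ChainRule

variable {𝕜 : Type*} [RCLike 𝕜]
  {E : Type u} [AddCommGroup E] [Module 𝕜 E] [TopologicalSpace E]
  {F : Type v} [AddCommGroup F] [Module 𝕜 F]
  {H : Type w} [AddCommGroup H] [Module 𝕜 H] [Module ℝ H] [IsScalarTower ℝ 𝕜 H]
  [TopologicalSpace H] [IsTopologicalAddGroup H] [ContinuousSMul ℝ H]

/-- Mean value theorem: if all directional derivatives along the segment from `y` to `y + t k`
lie in the open convex set `C`, then so does the difference quotient. Otherwise a continuous
linear functional would separate the quotient from `C`, contradicting the mean value theorem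
for real functions. -/
theorem inv_smul_sub_mem_of_convex {g : F → H} {dg : F × F → H} {V : Set F}
    (hd : ∀ x ∈ V, ∀ h : F,
      Tendsto (fun t : 𝕜 => t⁻¹ • (g (x + t • h) - g x)) (𝓝[≠] 0) (𝓝 (dg (x, h))))
    {C : Set H} (hC : Convex ℝ C) (hCo : IsOpen C) {y k : F} {t : 𝕜} (ht : t ≠ 0)
    (hV : ∀ s ∈ Icc (0 : ℝ) 1, y + ((s : 𝕜) * t) • k ∈ V)
    (hdC : ∀ s ∈ Icc (0 : ℝ) 1, dg (y + ((s : 𝕜) * t) • k, k) ∈ C) :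
    t⁻¹ • (g (y + t • k) - g y) ∈ C := by
  by_contra hq
  obtain ⟨l, hl⟩ := geometric_hahn_banach_point_open hC hCo hq
  set φ : ℝ → ℝ := fun s => l (t⁻¹ • g (y + ((s : 𝕜) * t) • k)) with hφ
  have hder : ∀ s ∈ Icc (0 : ℝ) 1,
      HasDerivAt φ (l (dg (y + ((s : 𝕜) * t) • k, k))) s := by
    intro s hs
    rw [hasDerivAt_iff_tendsto_slope_zero]
    have hτ : Tendsto (fun τ : ℝ => (τ : 𝕜) * t) (𝓝[≠] 0) (𝓝[≠] 0) := by
      refine tendsto_nhdsWithin_iff.2 ⟨?_, ?_⟩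
      · have : Continuous fun τ : ℝ => (τ : 𝕜) * t := by fun_prop
        simpa using (this.tendsto 0).mono_left nhdsWithin_le_nhds
      · filter_upwards [self_mem_nhdsWithin] with τ (hτ : τ ≠ 0)
        simpa [ht] using hτ
    refine ((l.continuous.tendsto _).comp ((hd _ (hV s hs) k).comp hτ)).congr fun τ => ?_
    have hpt : y + ((s : 𝕜) * t) • k + ((τ : 𝕜) * t) • k
        = y + (((s + τ : ℝ) : 𝕜) * t) • k := by
      rw [add_assoc, ← add_smul]; push_cast; rw [add_mul]
    have hsc : ∀ z : H, ((τ : 𝕜) * t)⁻¹ • z = τ⁻¹ • t⁻¹ • z := fun z => by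
      rw [mul_inv, mul_smul, ← RCLike.ofReal_inv,
        RCLike.real_smul_eq_coe_smul (K := 𝕜) τ⁻¹]
    simp only [Function.comp_apply, hφ, hpt, hsc, map_smul, smul_sub, map_sub]
  obtain ⟨s, hs, hs'⟩ := exists_hasDerivAt_eq_slope φ _ zero_lt_one
    (fun s hs => (hder s hs).continuousAt.continuousWithinAt)
    (fun s hs => hder s (Ioo_subset_Icc_self hs))
  refine (hl _ (hdC s (Ioo_subset_Icc_self hs))).ne ?_
  rw [hs']
  simp [hφ, smul_sub]

variable [TopologicalSpace F] [ContinuousAdd F] [ContinuousSMul 𝕜 F]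

/-- A `C^1` map is Hadamard differentiable: the difference quotients converge to the directional
derivative even if the direction varies. -/
theorem tendsto_inv_smul_sub [LocallyConvexSpace ℝ H] {g : F → H} {dg : F × F → H} {V : Set F}
    (hVo : IsOpen V) (hd : ∀ x ∈ V, ∀ h : F,
      Tendsto (fun t : 𝕜 => t⁻¹ • (g (x + t • h) - g x)) (𝓝[≠] 0) (𝓝 (dg (x, h))))
    (hdc : ContinuousOn dg (V ×ˢ univ)) {y : F} (hy : y ∈ V) (h : F) :
    Tendsto (fun p : 𝕜 × F => p.1⁻¹ • (g (y + p.1 • p.2) - g y)) (𝓝[≠] 0 ×ˢ 𝓝 h)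
      (𝓝 (dg (y, h))) := by
  refine tendsto_def.2 fun O hO => ?_
  obtain ⟨C, ⟨hC, hCo, hCc⟩, hCO⟩ : ∃ C : Set H, (dg (y, h) ∈ C ∧ IsOpen C ∧ Convex ℝ C) ∧
      C ⊆ O := by
    obtain ⟨C, ⟨hC, hCc⟩, hCO⟩ :=
      ((LocallyConvexSpace.convex_basis (𝕜 := ℝ) (dg (y, h))).mem_iff).1 hO
    exact ⟨interior C, ⟨mem_interior_iff_mem_nhds.2 hC, isOpen_interior, hCc.interior⟩,
      interior_subset.trans hCO⟩
  -- Near `(0, h)` the points `(y + σ k, k)` stay where `dg` takes values in `C`.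
  have hnear : ∀ᶠ q : 𝕜 × F in 𝓝 0 ×ˢ 𝓝 h, y + q.1 • q.2 ∈ V ∧ dg (y + q.1 • q.2, q.2) ∈ C := by
    have hcont : Tendsto (fun q : 𝕜 × F => (y + q.1 • q.2, q.2)) (𝓝 0 ×ˢ 𝓝 h) (𝓝 (y, h)) := by
      have : Continuous fun q : 𝕜 × F => (y + q.1 • q.2, q.2) := by fun_prop
      simpa [nhds_prod_eq] using this.tendsto (0, h)
    have hmem : V ×ˢ univ ∈ 𝓝 (y, h) := (hVo.prod isOpen_univ).mem_nhds ⟨hy, mem_univ _⟩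
    filter_upwards [hcont.eventually hmem,
      hcont.eventually ((hdc.continuousAt hmem).eventually (hCo.mem_nhds hC))] with q h1 h2
    exact ⟨h1.1, h2⟩
  obtain ⟨A, hA, K, hK, hAK⟩ := mem_prod_iff.1 hnear
  obtain ⟨δ, hδ, hball⟩ := Metric.mem_nhds_iff.1 hA
  have h1 : ∀ᶠ p : 𝕜 × F in 𝓝[≠] 0 ×ˢ 𝓝 h, p.1 ∈ Metric.ball (0 : 𝕜) δ ∧ p.1 ≠ 0 :=
    tendsto_fst.eventually (inter_mem (mem_nhdsWithin_of_mem_nhds (Metric.ball_mem_nhds _ hδ))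
      self_mem_nhdsWithin)
  have h2 : ∀ᶠ p : 𝕜 × F in 𝓝[≠] 0 ×ˢ 𝓝 h, p.2 ∈ K := tendsto_snd.eventually hK
  filter_upwards [h1, h2] with p hp hpK
  have key : ∀ s ∈ Icc (0 : ℝ) 1,
      y + ((s : 𝕜) * p.1) • p.2 ∈ V ∧ dg (y + ((s : 𝕜) * p.1) • p.2, p.2) ∈ C := by
    intro s hs
    refine hAK (a := ((s : 𝕜) * p.1, p.2)) ⟨hball ?_, hpK⟩
    have : ‖(s : 𝕜) * p.1‖ ≤ ‖p.1‖ := by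
      rw [norm_mul, RCLike.norm_ofReal, abs_of_nonneg hs.1]
      exact mul_le_of_le_one_left (norm_nonneg _) hs.2
    exact mem_ball_zero_iff.2 (this.trans_lt (mem_ball_zero_iff.1 hp.1))
  exact hCO (inv_smul_sub_mem_of_convex hd hCc hCo hp.2 (fun s hs => (key s hs).1)
    fun s hs => (key s hs).2)

/-- The chain rule: `d(g ∘ f)(x, h) = dg (f x, df (x, h))`. -/
theorem CDiffOn.comp [LocallyConvexSpace ℝ H] {n : ℕ} {f : E → F} {g : F → H} {U : Set E}
    {V : Set F} (hV : IsOpen V) (hg : CDiffOn 𝕜 n g V) (hf : CDiffOn 𝕜 n f U) :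
    CDiffOn 𝕜 n (g ∘ f) (U ∩ f ⁻¹' V) := by
  induction n generalizing E F with
  | zero => exact ContinuousOn.comp hg (ContinuousOn.mono hf inter_subset_left) fun _ hx => hx.2
  | succ n ih =>
    have hf' := hf.of_succ
    obtain ⟨hfc, df, hdf, hdfn⟩ := hf
    obtain ⟨hgc, dg, hdg, hdgn⟩ := hg
    refine ⟨hgc.comp (hfc.mono inter_subset_left) fun _ hx => hx.2,
      dg ∘ fun p => (f p.1, df p), fun x hx h => ?_, ?_⟩
    · have hk := (tendsto_inv_smul_sub hV hdg hdgn.continuousOn hx.2 (df (x, h))).comp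
        (tendsto_id.prodMk (hdf x hx.1 h))
      refine hk.congr' ?_
      filter_upwards [self_mem_nhdsWithin] with t (ht : t ≠ 0)
      simp [smul_inv_smul₀ ht]
    · have hfst : CDiffOn 𝕜 n (fun p : E × E => f p.1) (U ×ˢ univ) :=
        (hf'.comp_continuousLinearMap (ContinuousLinearMap.fst 𝕜 E E)).mono fun p hp => hp.1
      exact (ih (hV.prod isOpen_univ) hdgn (hfst.prodMk hdfn)).mono
        fun p hp => ⟨⟨hp.1.1, mem_univ _⟩, hp.1.2, mem_univ _⟩

end ChainRule

/-! ### Complexifications -/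

namespace Complexify

variable {E : Type u} {F : Type v} {H : Type w}

section Continuity

variable [TopologicalSpace E]

theorem continuous_re : Continuous (re : Complexify E → E) :=
  (continuous_fst : Continuous (Prod.fst : E × E → E))

theorem continuous_im : Continuous (im : Complexify E → E) :=
  (continuous_snd : Continuous (Prod.snd : E × E → E))

theorem continuous_mk {X : Type*} [TopologicalSpace X] {a b : X → E} (ha : Continuous a)
    (hb : Continuous b) : Continuous fun x => mk (a x) (b x) :=
  (ha.prodMk hb : Continuous fun x => (a x, b x))

theorem continuous_mk_zero [Zero E] : Continuous fun x : E => mk x 0 :=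
  continuous_mk continuous_id continuous_const

instance [T2Space E] : T2Space (Complexify E) := inferInstanceAs (T2Space (E × E))

instance [AddCommGroup E] [IsTopologicalAddGroup E] : IsTopologicalAddGroup (Complexify E) :=
  inferInstanceAs (IsTopologicalAddGroup (E × E))

end Continuity

variable [AddCommGroup E] [Module ℝ E] [TopologicalSpace E]
  [AddCommGroup F] [Module ℝ F] [TopologicalSpace F]
  [AddCommGroup H] [Module ℝ H] [TopologicalSpace H]

instance [IsTopologicalAddGroup E] [ContinuousSMul ℝ E] : ContinuousSMul ℂ (Complexify E) where
  continuous_smul := by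
    have hre := continuous_re.comp (continuous_snd : Continuous (Prod.snd : ℂ × Complexify E → _))
    have him := continuous_im.comp (continuous_snd : Continuous (Prod.snd : ℂ × Complexify E → _))
    have hcre := Complex.continuous_re.comp
      (continuous_fst : Continuous (Prod.fst : ℂ × Complexify E → _))
    have hcim := Complex.continuous_im.comp
      (continuous_fst : Continuous (Prod.fst : ℂ × Complexify E → _))
    exact continuous_mk ((hcre.smul hre).sub (hcim.smul him))
      ((hcre.smul him).add (hcim.smul hre))

instance [IsTopologicalAddGroup E] [ContinuousSMul ℝ E] : ContinuousSMul ℝ (Complexify E) :=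
  IsScalarTower.continuousSMul (M := ℝ) (α := Complexify E) ℂ

instance [LocallyConvexSpace ℝ E] [IsTopologicalAddGroup E] [ContinuousSMul ℝ E] :
    LocallyConvexSpace ℝ (Complexify E) := by
  let L : Complexify E →ₗ[ℝ] E × E :=
    { toFun := fun z => (z.re, z.im)
      map_add' := fun _ _ => rfl
      map_smul' := fun r z => by
        refine Prod.ext ?_ ?_
        · change (r : ℂ).re • z.re - (r : ℂ).im • z.im = r • z.re
          simp
        · change (r : ℂ).re • z.im + (r : ℂ).im • z.re = r • z.im
          simp }
  have hL : IsInducing L := (IsInducing.id : IsInducing (id : E × E → E × E))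
  exact hL.locallyConvexSpace

/-- The complexification of a continuous linear map. -/
def map (L : E →L[ℝ] F) : Complexify E →L[ℂ] Complexify F where
  toFun z := mk (L z.re) (L z.im)
  map_add' z w := ext' (map_add L z.re w.re) (map_add L z.im w.im)
  map_smul' c z := by
    apply ext'
    · change L (c.re • z.re - c.im • z.im) = c.re • L z.re - c.im • L z.im
      simp
    · change L (c.re • z.im + c.im • z.re) = c.re • L z.im + c.im • L z.re
      simp
  cont := continuous_mk (L.continuous.comp continuous_re) (L.continuous.comp continuous_im)

theorem map_mk_zero (L : E →L[ℝ] F) (x : E) : map L (mk x 0) = mk (L x) 0 :=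
  ext' rfl (map_zero L)

/-- The identification of the product of two complexifications with the complexification of the
product. -/
def prod : Complexify F × Complexify H →L[ℂ] Complexify (F × H) where
  toFun p := mk (p.1.re, p.2.re) (p.1.im, p.2.im)
  map_add' _ _ := rfl
  map_smul' _ _ := rfl
  cont := continuous_mk
    ((continuous_re.comp continuous_fst).prodMk (continuous_re.comp continuous_snd))
    ((continuous_im.comp continuous_fst).prodMk (continuous_im.comp continuous_snd))

end Complexify

/-! ### Smooth and real analytic maps between open subsets of locally convex spaces -/

namespace Regularity.DiffOn

variable {r : Regularity}
  {E : Type u} [AddCommGroup E] [Module ℝ E] [TopologicalSpace E]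
  {F : Type v} [AddCommGroup F] [Module ℝ F] [TopologicalSpace F]
  {H : Type w} [AddCommGroup H] [Module ℝ H] [TopologicalSpace H]
  {f : E → F} {U : Set E}

theorem continuousOn (hf : r.DiffOn f U) : ContinuousOn f U := by
  cases r with
  | smooth => exact (hf 0).continuousOn
  | analytic =>
    intro x hx
    obtain ⟨W, hW, hxW, g, hg, hgf⟩ := hf x hx
    have hgc : ContinuousAt g (Complexify.mk x 0) :=
      (hg 0).continuousOn.continuousAt (hW.mem_nhds hxW)
    have hre := Complexify.continuous_re.continuousAt.comp
      (ContinuousAt.comp (f := fun y => Complexify.mk y 0) hgc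
        Complexify.continuous_mk_zero.continuousAt)
    refine hre.continuousWithinAt.congr_of_eventuallyEq ?_ ?_
    · filter_upwards [self_mem_nhdsWithin, mem_nhdsWithin_of_mem_nhds
        ((hW.preimage Complexify.continuous_mk_zero).mem_nhds hxW)] with y hy hyW
      exact (congrArg Complexify.re (hgf y hy hyW)).symm
    · exact (congrArg Complexify.re (hgf x hx hxW)).symm

theorem mono {U' : Set E} (hf : r.DiffOn f U) (hU : U' ⊆ U) : r.DiffOn f U' := by
  cases r with
  | smooth => exact fun n => (hf n).mono hU
  | analytic =>
    intro x hx
    obtain ⟨W, hW, hxW, g, hg, hgf⟩ := hf x (hU hx)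
    exact ⟨W, hW, hxW, g, hg, fun y hy => hgf y (hU hy)⟩

theorem prodMk {g : E → H} (hf : r.DiffOn f U) (hg : r.DiffOn g U) :
    r.DiffOn (fun x => (f x, g x)) U := by
  cases r with
  | smooth => exact fun n => (hf n).prodMk (hg n)
  | analytic =>
    intro x hx
    obtain ⟨W₁, hW₁, hxW₁, f', hf', hff'⟩ := hf x hx
    obtain ⟨W₂, hW₂, hxW₂, g', hg', hgg'⟩ := hg x hx
    refine ⟨W₁ ∩ W₂, hW₁.inter hW₂, ⟨hxW₁, hxW₂⟩, Complexify.prod ∘ fun z => (f' z, g' z),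
      fun n => (((hf' n).mono inter_subset_left).prodMk
        ((hg' n).mono inter_subset_right)).continuousLinearMap_comp Complexify.prod,
      fun y hy hyW => ?_⟩
    change Complexify.prod (f' _, g' _) = _
    rw [hff' y hy hyW.1, hgg' y hy hyW.2]
    rfl

theorem const (c : F) : r.DiffOn (fun _ : E => c) U := by
  cases r with
  | smooth => exact fun n => cDiffOn_const c n U
  | analytic =>
    exact fun x _ => ⟨univ, isOpen_univ, mem_univ _, fun _ => Complexify.mk c 0,
      fun n => cDiffOn_const _ n _, fun _ _ _ => rfl⟩

theorem continuousLinearMap (L : E →L[ℝ] F) : r.DiffOn L U := by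
  cases r with
  | smooth => exact fun n => ContinuousLinearMap.cDiffOn L n U
  | analytic =>
    exact fun x _ => ⟨univ, isOpen_univ, mem_univ _, Complexify.map L,
      fun n => ContinuousLinearMap.cDiffOn (Complexify.map L) n _,
      fun y _ _ => Complexify.map_mk_zero L y⟩

theorem congr [ContinuousAdd E] [ContinuousSMul ℝ E] {g : E → F} (hU : IsOpen U)
    (hf : r.DiffOn f U) (hfg : EqOn f g U) : r.DiffOn g U := by
  cases r with
  | smooth => exact fun n => (hf n).congr hU hfg
  | analytic =>
    intro x hx
    obtain ⟨W, hW, hxW, f', hf', hff'⟩ := hf x hx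
    exact ⟨W, hW, hxW, f', hf', fun y hy hyW => by rw [hff' y hy hyW, hfg hy]⟩

theorem of_locally [ContinuousAdd E] [ContinuousSMul ℝ E] [T2Space F] (hU : IsOpen U)
    (h : ∀ x ∈ U, ∃ W, IsOpen W ∧ x ∈ W ∧ r.DiffOn f (U ∩ W)) : r.DiffOn f U := by
  cases r with
  | smooth =>
    intro n
    refine CDiffOn.of_locally hU fun x hx => ?_
    obtain ⟨W, hW, hxW, hf⟩ := h x hx
    exact ⟨W, hW, hxW, hf n⟩
  | analytic =>
    intro x hx
    obtain ⟨W, hW, hxW, hf⟩ := h x hx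
    obtain ⟨W', hW', hxW', g, hg, hgf⟩ := hf x ⟨hx, hxW⟩
    exact ⟨W' ∩ Complexify.re ⁻¹' W, hW'.inter (hW.preimage Complexify.continuous_re),
      ⟨hxW', hxW⟩, g, fun n => (hg n).mono inter_subset_left,
      fun y hy hyW => hgf y ⟨hy, hyW.2⟩ hyW.1⟩

theorem comp [IsTopologicalAddGroup F] [ContinuousSMul ℝ F] [IsTopologicalAddGroup H]
    [ContinuousSMul ℝ H] [LocallyConvexSpace ℝ H] {g : F → H} {V : Set F}
    (hV : IsOpen V) (hg : r.DiffOn g V) (hf : r.DiffOn f U) :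
    r.DiffOn (g ∘ f) (U ∩ f ⁻¹' V) := by
  cases r with
  | smooth => exact fun n => CDiffOn.comp hV (hg n) (hf n)
  | analytic =>
    rintro x ⟨hx, hxV⟩
    obtain ⟨W, hW, hxW, f', hf', hff'⟩ := hf x hx
    obtain ⟨W', hW', hxW', g', hg', hgg'⟩ := hg (f x) hxV
    refine ⟨W ∩ f' ⁻¹' W', (hf' 0).continuousOn.isOpen_inter_preimage hW hW', ⟨hxW, ?_⟩, g' ∘ f',
      fun n => CDiffOn.comp hW' (hg' n) (hf' n), fun y hy hyW => ?_⟩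
    · rw [mem_preimage, hff' x hx hxW]
      exact hxW'
    · have hy' : f' (Complexify.mk y 0) = Complexify.mk (f y) 0 := hff' y hy.1 hyW.1
      have hyW' : f' (Complexify.mk y 0) ∈ W' := hyW.2
      rw [Function.comp_apply, hy', hgg' (f y) hy.2 (hy' ▸ hyW')]
      rfl

end Regularity.DiffOn

/-! ### Maps from open subsets of locally convex spaces into manifolds and Lie groups -/

section DiffInto

variable (r : Regularity)
  (E : Type u) [AddCommGroup E] [Module ℝ E] [TopologicalSpace E]
  {X : Type v} [AddCommGroup X] [Module ℝ X] [TopologicalSpace X]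

/-- The map `f`, from a locally convex space to a manifold modelled on `E`, is smooth
(resp. real analytic) on `U`. This is `MapDiffOn` for the identity chart of `X`; that `U` is open
is a hypothesis of the lemmas that need it. -/
structure DiffInto {M : Type*} [TopologicalSpace M] [ChartedSpace E M] (f : X → M)
    (U : Set X) : Prop where
  continuousOn : ContinuousOn f U
  diffOn : ∀ e ∈ atlas E M, r.DiffOn (e ∘ f) (U ∩ f ⁻¹' e.source)

variable {r E} {M : Type*} [TopologicalSpace M] [ChartedSpace E M] {f : X → M} {U : Set X}

namespace DiffInto

theorem const (c : M) : DiffInto r E (fun _ : X => c) U :=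
  ⟨continuousOn_const, fun e _ => Regularity.DiffOn.const (e c)⟩

theorem chart_symm [IsLCManifold r E M] {e : OpenPartialHomeomorph M E} (he : e ∈ atlas E M) :
    DiffInto r E e.symm e.target :=
  ⟨e.continuousOn_symm, fun e' he' => IsLCManifold.compatible e he e' he'⟩

theorem comp [IsTopologicalAddGroup X] [ContinuousSMul ℝ X] [IsTopologicalAddGroup E]
    [ContinuousSMul ℝ E] [LocallyConvexSpace ℝ E]
    {Y : Type w} [AddCommGroup Y] [Module ℝ Y] [TopologicalSpace Y] {a : Y → X} {V : Set Y}
    (hf : DiffInto r E f U) (hU : IsOpen U) (ha : r.DiffOn a V) :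
    DiffInto r E (f ∘ a) (V ∩ a ⁻¹' U) :=
  ⟨hf.continuousOn.comp (ha.continuousOn.mono inter_subset_left) fun _ hx => hx.2,
    fun e he => ((hf.diffOn e he).comp (hf.continuousOn.isOpen_inter_preimage hU e.open_source)
      ha).mono fun _ hx => ⟨hx.1.1, hx.1.2, hx.2⟩⟩

/-- If `p : M → F` is smooth on `Ω` in all charts of `M` and `f` is a smooth map into `M`, then
`p ∘ f` is smooth. -/
theorem left_comp [IsTopologicalAddGroup X] [ContinuousSMul ℝ X] [IsTopologicalAddGroup E]
    [ContinuousSMul ℝ E]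
    {F : Type w} [AddCommGroup F] [Module ℝ F] [TopologicalSpace F] [IsTopologicalAddGroup F]
    [ContinuousSMul ℝ F] [LocallyConvexSpace ℝ F] [T2Space F] {p : M → F} {Ω : Set M}
    (hf : DiffInto r E f U) (hU : IsOpen U) (hΩ : IsOpen Ω)
    (hp : ∀ e ∈ atlas E M, r.DiffOn (p ∘ e.symm) (e.target ∩ e.symm ⁻¹' Ω)) :
    r.DiffOn (p ∘ f) (U ∩ f ⁻¹' Ω) := by
  have hUΩ : IsOpen (U ∩ f ⁻¹' Ω) := hf.continuousOn.isOpen_inter_preimage hU hΩ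
  refine Regularity.DiffOn.of_locally hUΩ fun x hx => ?_
  let e := chartAt E (f x)
  have he : e ∈ atlas E M := chart_mem_atlas E (f x)
  have hW : IsOpen (U ∩ f ⁻¹' e.source) := hf.continuousOn.isOpen_inter_preimage hU e.open_source
  refine ⟨U ∩ f ⁻¹' e.source, hW, ⟨hx.1, mem_chart_source E (f x)⟩, ?_⟩
  refine (((hp e he).comp (e.isOpen_inter_preimage_symm hΩ) (hf.diffOn e he)).mono ?_).congr
    (hUΩ.inter hW) ?_
  · rintro y ⟨hy, hyW⟩
    refine ⟨hyW, e.map_source hyW.2, ?_⟩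
    change e.symm (e (f y)) ∈ Ω
    rw [e.left_inv hyW.2]
    exact hy.2
  · rintro y ⟨-, hyW⟩
    change p (e.symm (e (f y))) = p (f y)
    rw [e.left_inv hyW.2]

end DiffInto

end DiffInto

section LieGroup

variable {r : Regularity} {E : Type u} [AddCommGroup E] [Module ℝ E] [TopologicalSpace E]
  {G : Type*} [Group G] [TopologicalSpace G] [ChartedSpace E G]

variable (r E G) in
theorem IsLCLieGroup.isTopologicalGroup [IsLCLieGroup r E G] : IsTopologicalGroup G where
  continuous_mul := continuousOn_univ.1 (IsLCLieGroup.mul_diff (r := r) (E := E) (G := G)).1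
  continuous_inv := continuousOn_univ.1 (IsLCLieGroup.inv_diff (r := r) (E := E) (G := G)).1

/-- Products of smooth maps into a Lie group are smooth: locally, such a product is multiplication
in charts composed with a map between locally convex spaces. -/
theorem DiffInto.mul [IsLCLieGroup r E G] [IsTopologicalAddGroup E]
    [ContinuousSMul ℝ E] [LocallyConvexSpace ℝ E] [T2Space E]
    {X : Type v} [AddCommGroup X] [Module ℝ X] [TopologicalSpace X] [IsTopologicalAddGroup X]
    [ContinuousSMul ℝ X] {f g : X → G} {U : Set X} (hU : IsOpen U)
    (hf : DiffInto r E f U) (hg : DiffInto r E g U) : DiffInto r E (fun x => f x * g x) U := by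
  have := IsLCLieGroup.isTopologicalGroup r E G
  have hfg : ContinuousOn (fun x => f x * g x) U := hf.continuousOn.mul hg.continuousOn
  refine ⟨hfg, fun e he => ?_⟩
  have hUe := hfg.isOpen_inter_preimage hU e.open_source
  refine Regularity.DiffOn.of_locally hUe fun x hx => ?_
  let e₁ := chartAt E (f x)
  let e₂ := chartAt E (g x)
  have he₁ : e₁ ∈ atlas E G := chart_mem_atlas E (f x)
  have he₂ : e₂ ∈ atlas E G := chart_mem_atlas E (g x)
  have hW₁ : IsOpen (U ∩ f ⁻¹' e₁.source) :=
    hf.continuousOn.isOpen_inter_preimage hU e₁.open_source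
  have hW₂ : IsOpen (U ∩ g ⁻¹' e₂.source) :=
    hg.continuousOn.isOpen_inter_preimage hU e₂.open_source
  have hpair := ((hf.diffOn e₁ he₁).mono (inter_subset_left (t := U ∩ g ⁻¹' e₂.source))).prodMk
    ((hg.diffOn e₂ he₂).mono (inter_subset_right (s := U ∩ f ⁻¹' e₁.source)))
  have hmul := (IsLCLieGroup.mul_diff (r := r) (E := E) (G := G)).2 (e₁.prod e₂)
    (mem_image2_of_mem he₁ he₂) e he
  have hO : IsOpen ((e₁.prod e₂).target ∩
      (e₁.prod e₂).symm ⁻¹' (univ ∩ (fun p : G × G => p.1 * p.2) ⁻¹' e.source)) :=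
    (e₁.prod e₂).isOpen_inter_preimage_symm
      (isOpen_univ.inter (e.open_source.preimage continuous_mul))
  refine ⟨_, hW₁.inter hW₂, ⟨⟨hx.1, mem_chart_source E _⟩, ⟨hx.1, mem_chart_source E _⟩⟩,
    ((hmul.comp hO hpair).mono ?_).congr (hUe.inter (hW₁.inter hW₂)) ?_⟩
  · rintro y ⟨hy, hy₁, hy₂⟩
    refine ⟨⟨hy₁, hy₂⟩, ⟨e₁.map_source hy₁.2, e₂.map_source hy₂.2⟩, mem_univ _, ?_⟩
    change e₁.symm (e₁ (f y)) * e₂.symm (e₂ (g y)) ∈ e.source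
    rw [e₁.left_inv hy₁.2, e₂.left_inv hy₂.2]
    exact hy.2
  · rintro y ⟨-, hy₁, hy₂⟩
    change e (e₁.symm (e₁ (f y)) * e₂.symm (e₂ (g y))) = e (f y * g y)
    rw [e₁.left_inv hy₁.2, e₂.left_inv hy₂.2]

end LieGroup

/-! ### Coordinates given by a slice -/

namespace QuotientSlice

variable {r : Regularity}
  {E : Type u} [AddCommGroup E] [Module ℝ E] [TopologicalSpace E]
  {F : Type v} [AddCommGroup F] [Module ℝ F] [TopologicalSpace F]
  {G : Type*} [Group G] [TopologicalSpace G] [ChartedSpace E G] {B : Subgroup G}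
  (S : QuotientSlice r E F B)

/-- The parametrization of the slice `N` by an open subset of `F`, as a map to `G`. -/
def incl (x : F) : G := (S.chart.symm x : G)

/-- The projection `n b ↦ n` from `Ω` to `N`, followed by the chart of `N`. -/
def coord (g : G) : F := S.chart (S.proj g)

theorem coord_mem (g : G) : S.coord g ∈ S.chart.target :=
  S.chart.map_source (S.chart_source ▸ mem_univ _)

theorem incl_mul_mem (x : F) {b : G} (hb : b ∈ B) : S.incl x * b ∈ S.Ω := by
  rw [← S.range_mul]
  exact ⟨(S.chart.symm x, ⟨b, hb⟩), rfl⟩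

theorem incl_mem (x : F) : S.incl x ∈ S.Ω := by
  simpa using S.incl_mul_mem x B.one_mem

theorem coord_incl_mul {x : F} (hx : x ∈ S.chart.target) {b : G} (hb : b ∈ B) :
    S.coord (S.incl x * b) = x := by
  rw [coord, incl, S.proj_mul (S.chart.symm x) ⟨b, hb⟩, S.chart.right_inv hx]

theorem coord_incl {x : F} (hx : x ∈ S.chart.target) : S.coord (S.incl x) = x := by
  simpa using S.coord_incl_mul hx B.one_mem

theorem exists_eq_incl_coord_mul {g : G} (hg : g ∈ S.Ω) :
    ∃ b ∈ B, g = S.incl (S.coord g) * b := by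
  rw [← S.range_mul] at hg
  obtain ⟨⟨n, b⟩, rfl⟩ := hg
  refine ⟨b, b.2, ?_⟩
  simp only [coord, incl, S.proj_mul, S.chart.left_inv (S.chart_source ▸ mem_univ n)]

theorem mul_mem_iff {g b : G} (hb : b ∈ B) : g * b ∈ S.Ω ↔ g ∈ S.Ω := by
  have key : ∀ {g b : G}, b ∈ B → g ∈ S.Ω → g * b ∈ S.Ω := by
    intro g b hb hg
    obtain ⟨c, hc, hgc⟩ := S.exists_eq_incl_coord_mul hg
    rw [hgc, mul_assoc]
    exact S.incl_mul_mem _ (B.mul_mem hc hb)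
  exact ⟨fun h => by simpa using key (B.inv_mem hb) h, key hb⟩

theorem coord_mul {g b : G} (hg : g ∈ S.Ω) (hb : b ∈ B) : S.coord (g * b) = S.coord g := by
  obtain ⟨c, hc, hgc⟩ := S.exists_eq_incl_coord_mul hg
  conv_lhs => rw [hgc, mul_assoc]
  exact S.coord_incl_mul (S.coord_mem g) (B.mul_mem hc hb)

/-- The parametrization `x ↦ g n(x) B` of the quotient is inverted by `h B ↦ coord (g⁻¹ h)`. -/
theorem mk_mul_incl_coord {g h : G} (hh : g⁻¹ * h ∈ S.Ω) :
    (QuotientGroup.mk (g * S.incl (S.coord (g⁻¹ * h))) : G ⧸ B) = QuotientGroup.mk h := by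
  obtain ⟨b, hb, hgb⟩ := S.exists_eq_incl_coord_mul hh
  rw [QuotientGroup.eq]
  have : (g * S.incl (S.coord (g⁻¹ * h)))⁻¹ * h = b := by
    rw [mul_inv_rev, mul_assoc]
    nth_rewrite 2 [hgb]
    group
  rwa [this]

theorem continuousOn_coord : ContinuousOn S.coord S.Ω :=
  S.chart.continuousOn.comp S.proj_diff.1 fun _ _ => S.chart_source ▸ mem_univ _

theorem diffOn_coord_comp_chart_symm (e : OpenPartialHomeomorph G E) (he : e ∈ atlas E G) :
    r.DiffOn (S.coord ∘ e.symm) (e.target ∩ e.symm ⁻¹' S.Ω) :=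
  (S.proj_diff.2 e he S.chart (mem_singleton _)).mono fun _ hx =>
    ⟨hx.1, hx.2, mem_preimage.2 (S.chart_source ▸ mem_univ _)⟩

theorem diffInto_incl : DiffInto r E S.incl S.chart.target where
  continuousOn := continuous_subtype_val.comp_continuousOn S.chart.continuousOn_symm
  diffOn e he := (S.incl_diff.2 S.chart (mem_singleton _) e he).mono
    fun _ hx => ⟨hx.1, mem_univ _, hx.2⟩

/-! ### The charts of the quotient -/

theorem inv_mul_out_mem_iff (g h : G) :
    g⁻¹ * (QuotientGroup.mk h : G ⧸ B).out ∈ S.Ω ↔ g⁻¹ * h ∈ S.Ω := by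
  obtain ⟨b, hb⟩ := QuotientGroup.mk_out_eq_mul B h
  rw [hb, ← mul_assoc, S.mul_mem_iff b.2]

theorem coord_inv_mul_out {g h : G} (hh : g⁻¹ * h ∈ S.Ω) :
    S.coord (g⁻¹ * (QuotientGroup.mk h : G ⧸ B).out) = S.coord (g⁻¹ * h) := by
  obtain ⟨b, hb⟩ := QuotientGroup.mk_out_eq_mul B h
  rw [hb, ← mul_assoc, S.coord_mul hh b.2]

theorem isOpen_inv_mul_out_mem [IsTopologicalGroup G] (g : G) :
    IsOpen {q : G ⧸ B | g⁻¹ * q.out ∈ S.Ω} := by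
  rw [← (QuotientGroup.isQuotientMap_mk B).isOpen_preimage]
  convert S.isOpen_Ω.preimage (continuous_const_mul g⁻¹) using 1
  ext h
  exact S.inv_mul_out_mem_iff g h

/-- The chart of `G ⧸ B` around `g B`: the inverse of `n ↦ g n B`, in the coordinates of `N`.
The choice of the representative `q.out` does not matter (`coord_inv_mul_out`). -/
noncomputable def quotientChart [IsTopologicalGroup G] (g : G) :
    OpenPartialHomeomorph (G ⧸ B) F where
  toFun q := S.coord (g⁻¹ * q.out)
  invFun x := QuotientGroup.mk (g * S.incl x)
  source := {q | g⁻¹ * q.out ∈ S.Ω}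
  target := S.chart.target
  map_source' _ _ := S.coord_mem _
  map_target' x _ := by
    rw [mem_ofPred_eq, S.inv_mul_out_mem_iff, inv_mul_cancel_left]
    exact S.incl_mem x
  left_inv' q hq := by rw [S.mk_mul_incl_coord hq, QuotientGroup.out_eq']
  right_inv' x hx := by
    have hmem : g⁻¹ * (g * S.incl x) ∈ S.Ω := by
      rw [inv_mul_cancel_left]
      exact S.incl_mem x
    rw [S.coord_inv_mul_out hmem, inv_mul_cancel_left, S.coord_incl hx]
  open_source := S.isOpen_inv_mul_out_mem g
  open_target := S.chart.open_target
  continuousOn_toFun := by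
    rw [(QuotientGroup.isQuotientMap_mk B).continuousOn_isOpen_iff (S.isOpen_inv_mul_out_mem g)]
    refine ContinuousOn.congr (f := fun h : G => S.coord (g⁻¹ * h))
      (S.continuousOn_coord.comp (continuous_const_mul g⁻¹).continuousOn fun h hh => ?_)
      fun h hh => ?_
    · exact (S.inv_mul_out_mem_iff g h).1 hh
    · exact S.coord_inv_mul_out ((S.inv_mul_out_mem_iff g h).1 hh)
  continuousOn_invFun := QuotientGroup.continuous_mk.comp_continuousOn
    (continuousOn_const.mul S.diffInto_incl.continuousOn)

theorem quotientChart_mem_quotientAtlas [IsTopologicalGroup G] (g : G) :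
    S.quotientChart g ∈ S.quotientAtlas :=
  ⟨rfl, g, fun _ _ => rfl⟩

/-- A chart of the atlas sends `h B` to the coordinates of `g⁻¹ h` whenever `g⁻¹ h ∈ Ω`. -/
theorem exists_forall_mem_source_iff {e : OpenPartialHomeomorph (G ⧸ B) F}
    (he : e ∈ S.quotientAtlas) : ∃ g : G,
      (∀ x ∈ S.chart.target, e.symm x = (QuotientGroup.mk (g * S.incl x) : G ⧸ B)) ∧
      ∀ h : G, (QuotientGroup.mk h ∈ e.source ↔ g⁻¹ * h ∈ S.Ω) ∧
        (g⁻¹ * h ∈ S.Ω → e (QuotientGroup.mk h) = S.coord (g⁻¹ * h)) := by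
  obtain ⟨ht, g, hg⟩ := he
  replace hg : ∀ x ∈ S.chart.target, e.symm x = (QuotientGroup.mk (g * S.incl x) : G ⧸ B) := hg
  have hsymm : ∀ h, g⁻¹ * h ∈ S.Ω →
      e.symm (S.coord (g⁻¹ * h)) = (QuotientGroup.mk h : G ⧸ B) := fun h hh => by
    rw [hg _ (S.coord_mem _)]
    exact S.mk_mul_incl_coord hh
  have hmem : ∀ h, S.coord (g⁻¹ * h) ∈ e.target := fun h => ht ▸ S.coord_mem _
  refine ⟨g, hg, fun h => ⟨⟨fun hh => ?_, fun hh => ?_⟩, fun hh => ?_⟩⟩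
  · have heq : (QuotientGroup.mk (g * S.incl (e (QuotientGroup.mk h : G ⧸ B))) : G ⧸ B)
        = QuotientGroup.mk h :=
      (hg _ (ht ▸ e.map_source hh)).symm.trans (e.left_inv hh)
    rw [QuotientGroup.eq] at heq
    have := S.incl_mul_mem (e (QuotientGroup.mk h : G ⧸ B)) heq
    rwa [mul_inv_rev, mul_assoc, mul_inv_cancel_left] at this
  · rw [← hsymm h hh]
    exact e.map_target (hmem h)
  · rw [← hsymm h hh, e.right_inv (hmem h)]

/-- The key computation: composed with a smooth map into `G`, the chart of `G ⧸ B` with index `g`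
becomes a left translate by `g⁻¹` followed by the smooth coordinate map of the slice. -/
theorem diffOn_chart_mk_comp [IsLCLieGroup r E G] [IsTopologicalAddGroup E] [ContinuousSMul ℝ E]
    [LocallyConvexSpace ℝ E] [T2Space E] [IsTopologicalAddGroup F] [ContinuousSMul ℝ F]
    [LocallyConvexSpace ℝ F] [T2Space F]
    {X : Type w} [AddCommGroup X] [Module ℝ X] [TopologicalSpace X] [IsTopologicalAddGroup X]
    [ContinuousSMul ℝ X] {f : X → G} {U : Set X} (hU : IsOpen U) (hf : DiffInto r E f U)
    {e : OpenPartialHomeomorph (G ⧸ B) F} (he : e ∈ S.quotientAtlas) :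
    r.DiffOn (fun x => e (QuotientGroup.mk (f x)))
      (U ∩ {x | (QuotientGroup.mk (f x) : G ⧸ B) ∈ e.source}) := by
  obtain ⟨g, -, hg⟩ := S.exists_forall_mem_source_iff he
  have hgf : DiffInto r E (fun x => g⁻¹ * f x) U := (DiffInto.const g⁻¹).mul hU hf
  simp only [fun h => (hg h).1]
  exact (hgf.left_comp hU S.isOpen_Ω S.diffOn_coord_comp_chart_symm).congr
    (hgf.continuousOn.isOpen_inter_preimage hU S.isOpen_Ω) fun x hx => ((hg (f x)).2 hx.2).symm

/-- The transition maps between the charts given by two slices are smooth. -/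
theorem diffOn_transition [IsLCLieGroup r E G] [IsTopologicalAddGroup E] [ContinuousSMul ℝ E]
    [LocallyConvexSpace ℝ E] [T2Space E] [IsTopologicalAddGroup F] [ContinuousSMul ℝ F]
    {F' : Type w} [AddCommGroup F'] [Module ℝ F'] [TopologicalSpace F'] [IsTopologicalAddGroup F']
    [ContinuousSMul ℝ F'] [LocallyConvexSpace ℝ F'] [T2Space F'] (S' : QuotientSlice r E F' B)
    {e : OpenPartialHomeomorph (G ⧸ B) F} (he : e ∈ S.quotientAtlas)
    {e' : OpenPartialHomeomorph (G ⧸ B) F'} (he' : e' ∈ S'.quotientAtlas) :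
    r.DiffOn (e' ∘ e.symm) (e.target ∩ e.symm ⁻¹' e'.source) := by
  obtain ⟨g, hg, -⟩ := S.exists_forall_mem_source_iff he
  have hf : DiffInto r E (fun x => g * S.incl x) S.chart.target :=
    (DiffInto.const g).mul S.chart.open_target S.diffInto_incl
  rw [← he.1] at hg hf
  refine ((S'.diffOn_chart_mk_comp e.open_target hf he').mono ?_).congr
    (e.isOpen_inter_preimage_symm e'.open_source) ?_
  · rintro x ⟨hx, hx'⟩
    refine ⟨hx, ?_⟩
    rw [mem_ofPred_eq, ← hg x hx]
    exact hx'
  · rintro x ⟨hx, -⟩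
    rw [Function.comp_apply, hg x hx]

/-- Two slices, possibly with different model spaces, define the same smooth structure. -/
theorem mapDiff_id [IsLCLieGroup r E G] [IsTopologicalAddGroup E] [ContinuousSMul ℝ E]
    [LocallyConvexSpace ℝ E] [T2Space E] [IsTopologicalAddGroup F] [ContinuousSMul ℝ F]
    {F' : Type w} [AddCommGroup F'] [Module ℝ F'] [TopologicalSpace F'] [IsTopologicalAddGroup F']
    [ContinuousSMul ℝ F'] [LocallyConvexSpace ℝ F'] [T2Space F'] (S' : QuotientSlice r E F' B)
    [C : ChartedSpace F (G ⧸ B)] [C' : ChartedSpace F' (G ⧸ B)]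
    (hC : C.atlas = S.quotientAtlas) (hC' : C'.atlas = S'.quotientAtlas) :
    MapDiff r F F' (id : G ⧸ B → G ⧸ B) :=
  ⟨continuousOn_id, fun _ he _ he' => (S.diffOn_transition S' (hC ▸ he) (hC' ▸ he')).mono
    fun _ hx => ⟨hx.1, hx.2.2⟩⟩

/-- The charts of `G ⧸ B` given by the slice. Reducible, so that its atlas is seen to be
`S.quotientAtlas`. -/
@[reducible]
noncomputable def quotientChartedSpace [IsTopologicalGroup G] :
    ChartedSpace F (G ⧸ B) where
  atlas := S.quotientAtlas
  chartAt q := S.quotientChart q.out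
  mem_chart_source q := by
    change q.out⁻¹ * q.out ∈ S.Ω
    rw [inv_mul_cancel]
    exact S.one_mem_Ω
  chart_mem_atlas q := S.quotientChart_mem_quotientAtlas q.out

section Quotient

variable [IsLCLieGroup r E G] [IsTopologicalAddGroup E] [ContinuousSMul ℝ E]
  [LocallyConvexSpace ℝ E] [T2Space E] [IsTopologicalAddGroup F] [ContinuousSMul ℝ F]
  [LocallyConvexSpace ℝ F] [T2Space F] [C : ChartedSpace F (G ⧸ B)]

theorem isLCManifold_quotient (hB : IsClosed (B : Set G)) (hC : C.atlas = S.quotientAtlas) :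
    IsLCManifold r F (G ⧸ B) where
  t2 := by
    have := IsLCLieGroup.isTopologicalGroup r E G
    rw [t2Space_iff_of_isOpenQuotientMap QuotientGroup.isOpenQuotientMap_mk]
    simp only [QuotientGroup.eq]
    exact hB.preimage (continuous_fst.inv.mul continuous_snd)
  compatible _ he _ he' := S.diffOn_transition S (hC ▸ he) (hC ▸ he')

theorem mapDiff_mk (hC : C.atlas = S.quotientAtlas) :
    MapDiff r E F (QuotientGroup.mk : G → G ⧸ B) := by
  refine ⟨QuotientGroup.continuous_mk.continuousOn, fun e he e' he' => ?_⟩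
  have := IsLCLieGroup.isTopologicalGroup r E G
  exact (S.diffOn_chart_mk_comp e.open_target (DiffInto.chart_symm he) (hC ▸ he')).mono
    fun _ hx => ⟨hx.1, hx.2.2⟩

theorem mapDiff_smul (hC : C.atlas = S.quotientAtlas) :
    MapDiff r (E × F) F (fun p : G × (G ⧸ B) => p.1 • p.2) := by
  have := IsLCLieGroup.isTopologicalGroup r E G
  refine ⟨continuous_smul.continuousOn, ?_⟩
  rintro _ ⟨e, he, e', he', rfl⟩ e'' he''
  have hS' : e' ∈ S.quotientAtlas := hC ▸ he'
  have hS'' : e'' ∈ S.quotientAtlas := hC ▸ he''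
  obtain ⟨g, hg, -⟩ := S.exists_forall_mem_source_iff hS'
  have hU : IsOpen (e.target ×ˢ e'.target) := e.open_target.prod e'.open_target
  have hincl : DiffInto r E (fun x => g * S.incl x) e'.target := by
    rw [hS'.1]
    exact (DiffInto.const g).mul S.chart.open_target S.diffInto_incl
  -- On the domain of the product chart the action is `(y, x) ↦ e⁻¹(y) g n(x) B`.
  have hf : DiffInto r E (fun p : E × F => e.symm p.1 * (g * S.incl p.2))
      (e.target ×ˢ e'.target) := by
    refine DiffInto.mul hU ?_ ?_
    · have := (DiffInto.chart_symm (r := r) he).comp e.open_target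
        (Regularity.DiffOn.continuousLinearMap (ContinuousLinearMap.fst ℝ E F)
          (U := e.target ×ˢ e'.target))
      rwa [inter_eq_left.2 fun p hp => hp.1] at this
    · have := hincl.comp e'.open_target
        (Regularity.DiffOn.continuousLinearMap (ContinuousLinearMap.snd ℝ E F)
          (U := e.target ×ˢ e'.target))
      rwa [inter_eq_left.2 fun p hp => hp.2] at this
  have hval : ∀ p ∈ e.target ×ˢ e'.target, e.symm p.1 • e'.symm p.2 =
      (QuotientGroup.mk (e.symm p.1 * (g * S.incl p.2)) : G ⧸ B) := by
    intro p hp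
    rw [hg p.2 (hS'.1 ▸ hp.2)]
    rfl
  refine ((S.diffOn_chart_mk_comp hU hf hS'').mono ?_).congr
    ((e.prod e').isOpen_inter_preimage_symm
      (isOpen_univ.inter (e''.open_source.preimage continuous_smul))) ?_
  · rintro p ⟨hp, -, hp'⟩
    refine ⟨hp, ?_⟩
    rw [mem_ofPred_eq, ← hval p hp]
    exact hp'
  · rintro p ⟨hp, -⟩
    exact congrArg e'' (hval p hp).symm

end Quotient

end QuotientSlice

end LCLie

theorem lemmaA1 (r : Regularity)
    {E : Type*} [AddCommGroup E] [Module ℝ E] [TopologicalSpace E] [IsTopologicalAddGroup E]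
    [ContinuousSMul ℝ E] [LocallyConvexSpace ℝ E] [T2Space E]
    {G : Type*} [Group G] [TopologicalSpace G] [ChartedSpace E G] [IsLCLieGroup r E G]
    (B : Subgroup G) (hB : IsClosed (B : Set G))
    {F : Type*} [AddCommGroup F] [Module ℝ F] [TopologicalSpace F] [IsTopologicalAddGroup F]
    [ContinuousSMul ℝ F] [LocallyConvexSpace ℝ F] [T2Space F]
    (S : QuotientSlice r E F B) :
    (∃ C : ChartedSpace F (G ⧸ B),
      C.atlas = S.quotientAtlas ∧
      IsLCManifold r F (G ⧸ B) ∧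
      MapDiff r E F (QuotientGroup.mk : G → G ⧸ B) ∧
      IsOpenMap (QuotientGroup.mk : G → G ⧸ B) ∧
      MapDiff r (E × F) F (fun p : G × (G ⧸ B) => p.1 • p.2)) ∧
    (∀ (F' : Type*) [AddCommGroup F'] [Module ℝ F'] [TopologicalSpace F']
      [IsTopologicalAddGroup F'] [ContinuousSMul ℝ F'] [LocallyConvexSpace ℝ F'] [T2Space F']
      (S' : QuotientSlice r E F' B)
      (C : ChartedSpace F (G ⧸ B)) (C' : ChartedSpace F' (G ⧸ B)),
      C.atlas = S.quotientAtlas → C'.atlas = S'.quotientAtlas →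
        MapDiff r F F' (id : G ⧸ B → G ⧸ B) ∧ MapDiff r F' F (id : G ⧸ B → G ⧸ B)) := by
  have := IsLCLieGroup.isTopologicalGroup r E G
  refine ⟨?_, fun F' _ _ _ _ _ _ _ S' C C' hC hC' =>
    ⟨S.mapDiff_id S' hC hC', S'.mapDiff_id S hC' hC⟩⟩
  let _ := S.quotientChartedSpace
  exact ⟨S.quotientChartedSpace, rfl, S.isLCManifold_quotient hB rfl, S.mapDiff_mk rfl,
    QuotientGroup.isOpenMap_coe, S.mapDiff_smul rfl⟩
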